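/- Let $f:\mathbb{C}\to\mathbb{C}$ be an entire function and write $f^n$ for its $n$-th iterate. The grand orbit of $z\in\mathbb{C}$ is $\operatorname{GO}(z)=\{w\in\mathbb{C} : f^n(z)=f^m(w) \text{ for some } n,m\ge 0\}$, and $\operatorname{GO}(A)=\bigcup_{z\in A}\operatorname{GO}(z)$ for $A\subset\mathbb{C}$. Let $S(f)$ be the closure in $\mathbb{C}$ of the set of critical values and finite asymptotic values of $f$, let $\operatorname{Per}(f)$ be the set of periodic points of $f$, and put $\widehat{J}(f)=\overline{\operatorname{GO}(S(f)\cup\operatorname{Per}(f))}$ (closure in $\mathbb{C}$) and $\widehat{F}(f)=\mathbb{C}\setminus\widehat{J}(f)$. Let $V=\operatorname{GO}(C)$ be the grand orbit of a connected component $C$ of $\widehat{F}(f)$. Then the following are equivalent: (a) the grand orbit relation in $V$ is discrete, that is, $\operatorname{GO}(z)$ is a discrete set for every $z\in V$; (b) there exists $z\in V$ such that $\operatorname{GO}(z)$ is discrete; (c) for each $z\in V$ there exists a neighbourhood $U$ of $z$ such that $\operatorname{GO}(z')\cap U=\{z'\}$ for all $z'\in U$. Suppose in addition that $V$ is contained in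 the grand orbit of a wandering domain of $f$, that is, of a component $U_0$ of the Fatou set of $f$ for which the Fatou components $U_n\supset f^n(U_0)$, $n\ge 0$, are pairwise disjoint. Then (a), (b) and (c) are also equivalent to (d) there exists a simply connected domain $W\subset V$ such that $f|_{f^n(W)}$ is injective for all $n\ge 0$. -/

import Mathlib

open Set Filter Topology

/-- The grand orbit of the point `z`: all `w` with `f^n(z) = f^m(w)` for some `n, m ≥ 0`. -/
def grandOrbit (f : ℂ → ℂ) (z : ℂ) : Set ℂ :=
  {w | ∃ n m : ℕ, f^[n] z = f^[m] w}

/-- The grand orbit of a set: the union of the grand orbits of its points. -/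
def grandOrbitSet (f : ℂ → ℂ) (A : Set ℂ) : Set ℂ :=
  ⋃ z ∈ A, grandOrbit f z

/-- The grand orbit relation on `V` is discrete if every grand orbit of a point of `V` is a
discrete set (every point of it is isolated in it). -/
def DiscreteGrandOrbitRelation (f : ℂ → ℂ) (V : Set ℂ) : Prop :=
  ∀ z ∈ V, IsDiscrete (grandOrbit f z)

/-- The set of critical values of `f`. -/
def criticalValues (f : ℂ → ℂ) : Set ℂ :=
  f '' {c | deriv f c = 0}

/-- The set of finite asymptotic values of `f`: the limits of `f` along curves
`γ : [0, ∞) → ℂ` tending to infinity. -/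
def asymptoticValues (f : ℂ → ℂ) : Set ℂ :=
  {a | ∃ γ : ℝ → ℂ, ContinuousOn γ (Ici 0) ∧ Tendsto γ atTop (cocompact ℂ) ∧
    Tendsto (fun t => f (γ t)) atTop (𝓝 a)}

/-- The set `S(f)` of singular values: critical values, asymptotic values and their
accumulation points. -/
def singularValues (f : ℂ → ℂ) : Set ℂ :=
  closure (criticalValues f ∪ asymptoticValues f)

/-- The set of dynamically marked points: the closure (in `ℂ`) of the grand orbit of the
singular values and the periodic points. -/
def markedJulia (f : ℂ → ℂ) : Set ℂ :=
  closure (grandOrbitSet f (singularValues f ∪ Function.periodicPts f))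

/-- The complement of the set of dynamically marked points. -/
def markedFatou (f : ℂ → ℂ) : Set ℂ :=
  (markedJulia f)ᶜ

/-- `C` is a connected component of the set `A`. -/
def IsComponentOf (C A : Set ℂ) : Prop :=
  ∃ z ∈ A, C = connectedComponentIn A z

/-- The family of restrictions to `N` of the iterates of `f`, with values in the Riemann sphere
`OnePoint ℂ`. -/
def iterateFamily (f : ℂ → ℂ) (N : Set ℂ) : Set C(N, OnePoint ℂ) :=
  {g | ∃ n : ℕ, ∀ x : N, g x = ((f^[n] (x : ℂ) : ℂ) : OnePoint ℂ)}

/-- A family of continuous maps from `N` to the Riemann sphere is normal if each sequence in it has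
a subsequence that converges locally uniformly on `N` for the spherical metric; for open `N` this
is convergence in the compact-open topology, which is the topology of `C(N, OnePoint ℂ)`. -/
def IsNormalFamily {N : Set ℂ} (S : Set C(N, OnePoint ℂ)) : Prop :=
  ∀ g : ℕ → C(N, OnePoint ℂ), (∀ j, g j ∈ S) →
    ∃ φ : ℕ → ℕ, StrictMono φ ∧ ∃ h : C(N, OnePoint ℂ),
      Tendsto (fun j => g (φ j)) atTop (𝓝 h)

/-- The Fatou set of `f`: the points that have an open neighbourhood on which the iterates of `f`
form a normal family. -/
def fatouSet (f : ℂ → ℂ) : Set ℂ :=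
  {z | ∃ N : Set ℂ, IsOpen N ∧ z ∈ N ∧ IsNormalFamily (iterateFamily f N)}

/-- `U` is a wandering domain of `f`: a Fatou component such that the Fatou components `U_n` with
`U_0 = U` and `f(U_n) ⊆ U_{n+1}` are pairwise disjoint. -/
def IsWanderingDomain (f : ℂ → ℂ) (U : Set ℂ) : Prop :=
  ∃ D : ℕ → Set ℂ, D 0 = U ∧ (∀ n, IsComponentOf (D n) (fatouSet f)) ∧
    (∀ n, f '' D n ⊆ D (n + 1)) ∧ ∀ m n, m ≠ n → Disjoint (D m) (D n)

/-! On a disc `D` in the marked Fatou set, inverse branches of every iterate continue along all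
paths, because no singular values are met. So each point of `GO(a)`, `a ∈ D`, is the value at `a` of
a holomorphic branch `φ` on all of `D` with `f^n = f^m ∘ φ` (`exists_isOrbitBranch`). There are no
preperiodic points either, so two branches that agree at one point coincide (`IsOrbitBranch.eqOn`):
distinct branches have disjoint graphs.

Suppose the relation is nontrivial in every neighbourhood of `c`. Then there are branches `φ ≠ id`
moving some point near `c` arbitrarily little. Fix one branch `α ≠ id`. The quotient `(φ - id)/(α -
id)` omits `0` and `1` and is small somewhere near `c`, so by Schottky's theorem it is small on a
fixed smaller disc. Hence every grand orbit through that disc accumulates at each of its points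
there. Local triviality and its failure are thus both open conditions, and both are invariant along
grand orbits, so connectedness of `C` makes one of them hold on all of `V`. This gives (a)–(c).

For (d), a small disc serves as `W` when the relation is locally trivial. Conversely, in a wandering
domain two nearby points with `f^n(x) = f^m(y)` must have `n = m`, and injectivity of the iterates
gives `x = y`. -/

/-! ### Schottky's theorem by way of a weak Bloch theorem -/

open Metric Complex in
/-- Holomorphic logarithm on a disc with a prescribed value at the centre. -/
theorem exists_holomorphic_log_ball {h : ℂ → ℂ} {c : ℂ} {r : ℝ} (hr : 0 < r)
    (hh : DifferentiableOn ℂ h (ball c r)) (h0 : ∀ z ∈ ball c r, h z ≠ 0) {w : ℂ}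
    (hw : exp w = h c) :
    ∃ L : ℂ → ℂ, DifferentiableOn ℂ L (ball c r) ∧ L c = w ∧ ∀ z ∈ ball c r, exp (L z) = h z := by
  have hq : DifferentiableOn ℂ (fun z => deriv h z / h z) (ball c r) :=
    (hh.deriv isOpen_ball).div hh h0
  obtain ⟨L, hLc, hL⟩ := hq.isExactOn_ball.with_val_at c w
  refine ⟨L, fun z hz => (hL z hz).differentiableAt.differentiableWithinAt, hLc, fun z hz => ?_⟩
  have hc : c ∈ ball c r := mem_ball_self hr
  have hd : ∀ x ∈ ball c r, HasDerivAt (fun z => exp (-L z) * h z) 0 x := fun x hx => by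
    have h1 := ((hL x hx).fun_neg.cexp).fun_mul
      (hh.differentiableAt (isOpen_ball.mem_nhds hx)).hasDerivAt
    refine h1.congr_deriv ?_
    linear_combination -exp (-L x) * div_mul_cancel₀ (deriv h x) (h0 x hx)
  have heq := isOpen_ball.is_const_of_deriv_eq_zero (convex_ball c r).isPreconnected
    (fun x hx => (hd x hx).differentiableAt.differentiableWithinAt)
    (fun x hx => (hd x hx).deriv) hz hc
  simp only [hLc, ← hw, ← exp_add, neg_add_cancel, exp_zero] at heq
  rw [exp_neg, inv_mul_eq_one₀ (exp_ne_zero _)] at heq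
  exact heq

open Metric in
/-- A weak form of Bloch's theorem: if the image of the disc contains no disc of radius `2`, then
the derivative is bounded. -/
theorem norm_deriv_mul_le_of_no_ball_subset_image {g : ℂ → ℂ} {c : ℂ} {R : ℝ}
    (hg : DifferentiableOn ℂ g (ball c R))
    (hB : ∀ w : ℂ, ¬ ball w 2 ⊆ g '' ball c R) {r : ℝ} (hrR : r < R) {z : ℂ}
    (hz : z ∈ closedBall c r) : ‖deriv g z‖ * (r - dist z c) ≤ 96 := by
  have hsub : closedBall c r ⊆ ball c R := closedBall_subset_ball hrR
  have hg' : DifferentiableOn ℂ (deriv g) (ball c R) := hg.deriv isOpen_ball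
  -- Landau's trick: at a maximum `a` of the weighted derivative, `‖g'‖ ≤ 2 ‖g' a‖` on the disc
  -- whose radius `ρ` is half of `r - dist a c`.
  obtain ⟨a, ha, hmax⟩ := (isCompact_closedBall c r).exists_isMaxOn ⟨z, hz⟩
    (f := fun z => ‖deriv g z‖ * (r - dist z c))
    (((hg'.continuousOn.mono hsub).norm).mul (by fun_prop))
  refine (hmax hz).trans ?_
  by_contra! hM
  have hra : 0 < r - dist a c := by
    by_contra! h
    nlinarith [norm_nonneg (deriv g a)]
  have hA : 0 < ‖deriv g a‖ := by
    by_contra! h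
    nlinarith [norm_nonneg (deriv g a)]
  set A := ‖deriv g a‖ with hAdef
  set ρ := (r - dist a c) / 2 with hρ
  have hρ0 : 0 < ρ := by positivity
  have hball : ball a ρ ⊆ closedBall c r := fun x hx => by
    rw [mem_ball] at hx
    rw [mem_closedBall]
    linarith [dist_triangle x a c]
  have hder : ∀ x ∈ ball a ρ, ‖deriv g x‖ ≤ 2 * A := fun x hx => by
    have h1 := hmax (hball hx)
    simp only [mem_ofPred_eq] at h1
    rw [mem_ball] at hx
    have h2 : ρ ≤ r - dist x c := by linarith [dist_triangle x a c]
    have h3 : ‖deriv g x‖ * ρ ≤ A * (2 * ρ) :=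
      (mul_le_mul_of_nonneg_left h2 (norm_nonneg _)).trans (h1.trans_eq (by rw [hρ]; ring))
    nlinarith
  have hgat : ∀ x ∈ ball a ρ, DifferentiableAt ℂ g x := fun x hx =>
    hg.differentiableAt (isOpen_ball.mem_nhds (hsub (hball hx)))
  have haρ : a ∈ ball a ρ := mem_ball_self hρ0
  set φ : ℂ → ℂ := fun x => g x - g a - deriv g a * (x - a) with hφ
  have hφa : φ a = 0 := by simp [hφ]
  have hφd : DifferentiableOn ℂ φ (ball a ρ) := fun x hx =>
    (((hgat x hx).sub_const _).sub (by fun_prop)).differentiableWithinAt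
  have hφm : MapsTo φ (ball a ρ) (closedBall (φ a) (3 * A * ρ)) := fun x hx => by
    have h1 := (convex_ball a ρ).norm_image_sub_le_of_norm_deriv_le (f := g) hgat hder haρ hx
    have h2 : ‖x - a‖ < ρ := by rwa [mem_ball, dist_eq_norm] at hx
    rw [hφa, mem_closedBall, dist_zero_right]
    calc ‖φ x‖ ≤ ‖g x - g a‖ + ‖deriv g a * (x - a)‖ := norm_sub_le _ _
      _ ≤ 2 * A * ‖x - a‖ + A * ‖x - a‖ := by rw [norm_mul]; gcongr
      _ ≤ 3 * A * ρ := by nlinarith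
  have hφo : (φ · - φ a) =o[𝓝 a] (fun w ↦ ‖w - a‖ ^ 1) := by
    have := (hgat a haρ).hasDerivAt.isLittleO
    simp only [pow_one]
    refine (this.norm_right).congr_left fun x => ?_
    simp [hφ, mul_comm]
  -- On this circle the linear term has modulus `Aρ/6`, and the second-order Schwarz lemma bounds
  -- the remainder by `3Aρ/36 = Aρ/12`. The image then contains a disc of radius `Aρ/24`, which
  -- exceeds `2` if the claimed bound `96` fails.
  have hlow : ∀ x ∈ sphere a (ρ / 6), A * ρ / 12 ≤ ‖g x - g a‖ := fun x hx => by
    have hx' : ‖x - a‖ = ρ / 6 := by rwa [mem_sphere, dist_eq_norm] at hx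
    have h1 := Complex.dist_le_mul_div_pow_of_mapsTo_ball_of_isLittleO hφd hφm hφo (z := x)
      (by rw [mem_ball, dist_eq_norm, hx']; linarith)
    rw [hφa, dist_zero_right, dist_eq_norm, hx'] at h1
    have h2 : 3 * A * ρ * (ρ / 6 / ρ) ^ (1 + 1) = A * ρ / 12 := by field_simp; norm_num
    have h3 : ‖deriv g a * (x - a)‖ = A * ρ / 6 := by rw [norm_mul, hx']; ring
    have h4 : ‖deriv g a * (x - a)‖ ≤ ‖g x - g a‖ + ‖φ x‖ := by
      have : deriv g a * (x - a) = (g x - g a) - φ x := by simp only [hφ]; ring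
      rw [this]; exact norm_sub_le _ _
    linarith
  have hcb : closedBall a (ρ / 6) ⊆ ball a ρ := closedBall_subset_ball (by linarith)
  have hdc : DiffContOnCl ℂ g (ball a (ρ / 6)) :=
    DifferentiableOn.diffContOnCl fun x hx =>
      (hgat x (hcb (closure_ball_subset_closedBall hx))).differentiableWithinAt
  have hfreq : ∃ᶠ x in 𝓝 a, g x ≠ g a := by
    have := (hgat a haρ).hasDerivAt.eventually_ne (c := g a) (norm_pos_iff.1 hA)
    exact this.frequently.filter_mono nhdsWithin_le_nhds
  refine hB (g a) ?_
  refine (ball_subset_ball ?_).trans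
    ((hdc.ball_subset_image_closedBall (by positivity) hlow hfreq).trans
      (image_mono (hcb.trans (hball.trans hsub))))
  have : A * ρ = A * (r - dist a c) / 2 := by rw [hρ]; ring
  linarith

/-- Every real interval of length `1` starting in `[0, ∞)` contains a point at which `sinh²` is a
natural number. -/
theorem exists_sinh_sq_eq_nat_of_nonneg {x : ℝ} (hx : 0 ≤ x) :
    ∃ t ∈ Icc x (x + 1), ∃ n : ℕ, Real.sinh t ^ 2 = n := by
  have h1 : Real.sinh x ^ 2 + 1 ≤ Real.sinh (x + 1) ^ 2 := by
    have h2 : 1 ≤ Real.sinh 1 := Real.self_le_sinh_iff.2 zero_le_one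
    have h3 : 1 ≤ Real.cosh 1 := Real.one_le_cosh 1
    have h4 : 0 ≤ Real.sinh x := Real.sinh_nonneg_iff.2 hx
    have h5 := Real.cosh_sq x
    have h6 : Real.sinh (x + 1) = Real.sinh x * Real.cosh 1 + Real.cosh x * Real.sinh 1 :=
      Real.sinh_add x 1
    have h7 := Real.one_le_cosh x
    have h8 : Real.sinh x + 1 * 1 ≤ Real.sinh (x + 1) := by
      rw [h6]
      gcongr
      exact le_mul_of_one_le_right h4 h3
    nlinarith
  have hc : ContinuousOn (fun t => Real.sinh t ^ 2) (Icc x (x + 1)) :=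
    (Real.continuous_sinh.pow 2).continuousOn
  obtain ⟨t, ht, hte⟩ := intermediate_value_Icc (by linarith) hc
    (show ((⌈Real.sinh x ^ 2⌉₊ : ℕ) : ℝ) ∈ _ from
      ⟨Nat.le_ceil _, (Nat.ceil_lt_add_one (sq_nonneg _)).le.trans h1⟩)
  exact ⟨t, ht, _, hte⟩

theorem exists_sinh_sq_eq_nat (x : ℝ) : ∃ t : ℝ, |t - x| ≤ 1 ∧ ∃ n : ℕ, Real.sinh t ^ 2 = n := by
  rcases le_total 0 x with hx | hx
  · obtain ⟨t, ht, n, hn⟩ := exists_sinh_sq_eq_nat_of_nonneg hx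
    exact ⟨t, abs_le.2 ⟨by linarith [ht.1], by linarith [ht.2]⟩, n, hn⟩
  · obtain ⟨t, ht, n, hn⟩ := exists_sinh_sq_eq_nat_of_nonneg (neg_nonneg.2 hx)
    exact ⟨-t, abs_le.2 ⟨by linarith [ht.2], by linarith [ht.1]⟩, n, by simpa using hn⟩

open Metric Complex in
/-- Every disc of radius `2` contains a point at which `cosh²` is an integer. -/
theorem exists_mem_ball_cosh_sq_eq_int (w : ℂ) : ∃ p ∈ ball w 2, ∃ n : ℤ, cosh p ^ 2 = n := by
  obtain ⟨t, ht, n, hn⟩ := exists_sinh_sq_eq_nat w.re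
  -- On the lines `Im = πm/2`, `cosh²` is `cosh² t` for even `m` and `-sinh² t` for odd `m`.
  -- Rounding costs at most `π/4` vertically and `1` horizontally, less than `2` in all.
  set m : ℤ := round (2 * w.im / Real.pi) with hm
  have hπ := Real.pi_pos
  have him : |Real.pi * m / 2 - w.im| ≤ Real.pi / 4 := by
    have h1 := abs_sub_round (2 * w.im / Real.pi)
    rw [← hm] at h1
    have h2 : Real.pi * m / 2 - w.im = -(Real.pi / 2) * (2 * w.im / Real.pi - m) := by
      field_simp
      ring
    rw [h2, abs_mul, abs_neg, abs_of_pos (by positivity)]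
    nlinarith
  have hsinh : sinh (t : ℂ) ^ 2 = n := by
    rw [← ofReal_sinh]
    exact_mod_cast congrArg ((↑) : ℝ → ℂ) hn
  have hcosh : cosh (t : ℂ) ^ 2 = n + 1 := by rw [cosh_sq, hsinh]
  refine ⟨t + (Real.pi * m / 2 : ℝ) * I, ?_, ?_⟩
  · rw [mem_ball, dist_eq_norm]
    refine (norm_le_abs_re_add_abs_im _).trans_lt ?_
    have h1 : ((t : ℂ) + (Real.pi * m / 2 : ℝ) * I - w).re = t - w.re := by
      simp only [sub_re, add_re, re_ofReal_mul, I_re, ofReal_re, mul_zero, add_zero]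
    have h2 : ((t : ℂ) + (Real.pi * m / 2 : ℝ) * I - w).im = Real.pi * m / 2 - w.im := by
      simp only [sub_im, add_im, im_ofReal_mul, I_im, ofReal_im, mul_one, zero_add]
    rw [h1, h2]
    linarith [Real.pi_lt_four]
  · rw [cosh_add, cosh_mul_I, sinh_mul_I]
    rcases Int.even_or_odd' m with ⟨k, hk | hk⟩
    · have e1 : ((Real.pi * m / 2 : ℝ) : ℂ) = k * Real.pi := by
        rw [hk]; push_cast; ring
      have e2 := sin_int_mul_pi k
      have e3 : cos (k * Real.pi : ℂ) ^ 2 = 1 := by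
        rw [cos_sq', e2]; norm_num
      refine ⟨n + 1, ?_⟩
      rw [e1, e2, zero_mul, mul_zero, add_zero, mul_pow, e3, hcosh]
      push_cast; ring
    · have e1 : ((Real.pi * m / 2 : ℝ) : ℂ) = k * Real.pi + Real.pi / 2 := by
        rw [hk]; push_cast; ring
      have e2 : cos ((k * Real.pi : ℂ) + Real.pi / 2) = 0 := by
        rw [cos_add_pi_div_two, sin_int_mul_pi, neg_zero]
      have e3 : sin ((k * Real.pi : ℂ) + Real.pi / 2) ^ 2 = 1 := by
        rw [sin_sq, e2]; norm_num
      refine ⟨-n, ?_⟩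
      rw [e1, e2, mul_zero, zero_add, mul_pow, mul_pow, e3, hsinh, I_sq]
      push_cast; ring

open Complex in
theorem norm_log_le_abs_log_norm_add_pi (z : ℂ) : ‖log z‖ ≤ |Real.log ‖z‖| + Real.pi := by
  refine (norm_le_abs_re_add_abs_im _).trans ?_
  rw [log_re, log_im]
  gcongr
  exact abs_arg_le_pi z

open Metric Complex in
/-- A holomorphic square root on a disc. -/
theorem exists_holomorphic_sqrt_ball {h : ℂ → ℂ} {c : ℂ} {r : ℝ} (hr : 0 < r)
    (hh : DifferentiableOn ℂ h (ball c r)) (h0 : ∀ z ∈ ball c r, h z ≠ 0) :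
    ∃ s : ℂ → ℂ, DifferentiableOn ℂ s (ball c r) ∧ ∀ z ∈ ball c r, s z ^ 2 = h z := by
  obtain ⟨L, hL, -, hLe⟩ := exists_holomorphic_log_ball hr hh h0 (exp_log (h0 c (mem_ball_self hr)))
  refine ⟨fun z => exp (L z / 2), (hL.div_const 2).cexp, fun z hz => ?_⟩
  rw [← exp_nat_mul, ← hLe z hz]
  congr 1
  push_cast
  ring

open Complex in
theorem norm_cosh_le_exp_norm (z : ℂ) : ‖cosh z‖ ≤ Real.exp ‖z‖ := by
  rw [cosh, norm_div, Complex.norm_ofNat, div_le_iff₀ two_pos]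
  refine (norm_add_le _ _).trans ?_
  have h1 := norm_exp_le_exp_norm z
  have h2 := norm_exp_le_exp_norm (-z)
  rw [norm_neg] at h2
  linarith

open Metric Complex in
/-- **Schottky's theorem**, for functions whose value at the centre has a prescribed modulus. -/
theorem schottky (K : ℝ) : ∃ M : ℝ, ∀ (h : ℂ → ℂ) (c : ℂ) (R : ℝ), 0 < R →
    DifferentiableOn ℂ h (ball c R) → (∀ z ∈ ball c R, h z ≠ 0) → (∀ z ∈ ball c R, h z ≠ 1) →
    ‖h c‖ = K → ∀ z ∈ closedBall c (R / 2), ‖h z‖ ≤ M := by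
  -- At the centre, `K₀` bounds `F` and `N` bounds `a ± b`; `T` bounds `H` on the half disc. The
  -- `192` is `R/2` times the derivative bound `96 / (R/4)`.
  set K₀ := |Real.log K| + Real.pi with hK₀
  set N := 2 * (2 + K₀) with hN
  set T := Real.log N + Real.pi + 192 with hT
  refine ⟨Real.exp (2 * Real.pi * Real.exp T ^ 2), fun h c R hR hh h0 h1 hK z hz => ?_⟩
  have hπ := Real.pi_pos
  have hK₀0 : 0 ≤ K₀ := by positivity
  have hc : c ∈ ball c R := mem_ball_self hR
  have hsub : closedBall c (R / 2) ⊆ ball c R := closedBall_subset_ball (by linarith)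
  obtain ⟨L, hL, hLc, hLe⟩ := exists_holomorphic_log_ball hR hh h0 (exp_log (h0 c hc))
  have h2πI : (2 * Real.pi * I : ℂ) ≠ 0 := two_pi_I_ne_zero
  have h2πn : ‖(2 * Real.pi * I : ℂ)‖ = 2 * Real.pi := by
    simp [abs_of_pos hπ]
  set F : ℂ → ℂ := fun z => L z / (2 * Real.pi * I) with hF
  have hFd : DifferentiableOn ℂ F (ball c R) := hL.div_const _
  have hFL : ∀ z, L z = F z * (2 * Real.pi * I) := fun z => by simp only [hF]; field_simp
  have hFint : ∀ z ∈ ball c R, ∀ n : ℤ, F z ≠ n := fun z hz n hn => by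
    refine h1 z hz ?_
    rw [← hLe z hz, hFL, hn, exp_int_mul_two_pi_mul_I]
  have hFc : ‖F c‖ ≤ K₀ := by
    have e1 : ‖L c‖ ≤ K₀ := by
      rw [hLc, hK₀, ← hK]; exact norm_log_le_abs_log_norm_add_pi _
    simp only [hF]
    rw [norm_div, h2πn]
    refine (div_le_self (norm_nonneg _) ?_).trans e1
    linarith [Real.pi_gt_three]
  -- `F` omits the integers. With `a² = F` and `b² = F - 1`, the function `a - b = exp H` has
  -- inverse `a + b`, so `a = cosh H`. Thus `cosh² H = F` omits the integers, and the image of `H`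
  -- contains no disc of radius `2`.
  obtain ⟨a, had, ha⟩ := exists_holomorphic_sqrt_ball hR hFd
    (fun z hz => by simpa using hFint z hz 0)
  obtain ⟨b, hbd, hb⟩ := exists_holomorphic_sqrt_ball hR (hFd.sub_const 1)
    (fun z hz => sub_ne_zero.2 (by simpa using hFint z hz 1))
  have hab : ∀ z ∈ ball c R, (a z - b z) * (a z + b z) = 1 := fun z hz => by
    linear_combination ha z hz - hb z hz
  have hab0 : ∀ z ∈ ball c R, a z - b z ≠ 0 := fun z hz => left_ne_zero_of_mul_eq_one (hab z hz)
  have hac : ‖a c‖ ≤ 2 + K₀ := by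
    have : ‖a c‖ ^ 2 ≤ K₀ := by rw [← norm_pow, ha c hc]; exact hFc
    nlinarith [norm_nonneg (a c)]
  have hbc : ‖b c‖ ≤ 2 + K₀ := by
    have : ‖b c‖ ^ 2 ≤ K₀ + 1 := by
      rw [← norm_pow, hb c hc]
      exact (norm_sub_le _ _).trans (by rw [norm_one]; linarith)
    nlinarith [norm_nonneg (b c)]
  obtain ⟨H, hHd, hHc, hHe⟩ := exists_holomorphic_log_ball hR (had.sub hbd) hab0
    (exp_log (hab0 c hc))
  have hcosh : ∀ z ∈ ball c R, cosh (H z) = a z := fun z hz => by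
    have e1 : exp (H z) = a z - b z := hHe z hz
    have e2 : exp (-H z) = a z + b z := by
      rw [exp_neg, e1]
      exact inv_eq_of_mul_eq_one_right (hab z hz)
    rw [cosh, e1, e2]
    ring
  have hB : ∀ w : ℂ, ¬ ball w 2 ⊆ H '' ball c R := fun w hw => by
    obtain ⟨p, hp, n, hn⟩ := exists_mem_ball_cosh_sq_eq_int w
    obtain ⟨x, hx, rfl⟩ := hw hp
    rw [hcosh x hx, ha x hx] at hn
    exact hFint x hx n hn
  have hHcn : ‖H c‖ ≤ Real.log N + Real.pi := by
    rw [hHc]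
    refine (norm_log_le_abs_log_norm_add_pi _).trans ?_
    have hpos : 0 < ‖a c - b c‖ := norm_pos_iff.2 (hab0 c hc)
    have e1 : ‖a c - b c‖ ≤ N := (norm_sub_le _ _).trans (by linarith)
    have e2 : ‖a c + b c‖ ≤ N := (norm_add_le _ _).trans (by linarith)
    have e3 : ‖a c - b c‖ * ‖a c + b c‖ = 1 := by rw [← norm_mul, hab c hc, norm_one]
    have hpos' : 0 < ‖a c + b c‖ := by
      by_contra! hle
      nlinarith
    have e4 : Real.log ‖a c - b c‖ + Real.log ‖a c + b c‖ = 0 := by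
      rw [← Real.log_mul hpos.ne' hpos'.ne', e3, Real.log_one]
    have e5 := Real.log_le_log hpos e1
    have e6 := Real.log_le_log hpos' e2
    have e7 : |Real.log ‖a c - b c‖| ≤ Real.log N := abs_le.2 ⟨by linarith, e5⟩
    exact add_le_add_left e7 _
  have hHz : ‖H z‖ ≤ T := by
    have e1 : ∀ x ∈ closedBall c (R / 2), ‖deriv H x‖ ≤ 384 / R := fun x hx => by
      have e2 := norm_deriv_mul_le_of_no_ball_subset_image hHd hB (r := 3 * R / 4) (by linarith)
        (z := x) (closedBall_subset_closedBall (by linarith) hx)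
      rw [mem_closedBall] at hx
      rw [le_div_iff₀ hR]
      nlinarith [norm_nonneg (deriv H x)]
    have e3 := (convex_closedBall c (R / 2)).norm_image_sub_le_of_norm_deriv_le (f := H)
      (fun x hx => hHd.differentiableAt (isOpen_ball.mem_nhds (hsub hx))) e1
      (mem_closedBall_self (by linarith)) hz
    rw [mem_closedBall, dist_eq_norm] at hz
    have e4 : 384 / R * ‖z - c‖ ≤ 192 := by
      calc 384 / R * ‖z - c‖ ≤ 384 / R * (R / 2) := by gcongr
        _ = 192 := by field_simp; norm_num
    have e5 : ‖H z‖ ≤ ‖H c‖ + ‖H z - H c‖ := by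
      have := norm_add_le (H c) (H z - H c)
      rwa [add_sub_cancel] at this
    linarith
  have hzb := hsub hz
  rw [← hLe z hzb]
  refine (norm_exp_le_exp_norm _).trans (Real.exp_le_exp.2 ?_)
  rw [hFL, norm_mul, h2πn, ← ha z hzb, ← hcosh z hzb, norm_pow, mul_comm]
  have := (norm_cosh_le_exp_norm (H z)).trans (Real.exp_le_exp.2 hHz)
  gcongr

open Metric in
/-- A holomorphic function without the values `0` and `1` which is small at one point is small on
a whole smaller disc. -/
theorem exists_norm_lt_of_omits_zero_one {ε : ℝ} (hε : 0 < ε) : ∃ δ > 0, ∀ (h : ℂ → ℂ) (p : ℂ)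
    (R : ℝ), DifferentiableOn ℂ h (ball p R) → (∀ z ∈ ball p R, h z ≠ 0) →
    (∀ z ∈ ball p R, h z ≠ 1) → ∀ a ∈ ball p (R / 5), ∀ b ∈ ball p (R / 5),
    ‖h a‖ < δ → ‖h b‖ < ε := by
  obtain ⟨M, hM⟩ := schottky ε⁻¹
  refine ⟨min ε (|M| + 1)⁻¹, lt_min hε (by positivity), fun h p R hd h0 h1 a ha b hb hlt => ?_⟩
  by_contra! hge
  have hR : 0 < R := by linarith [pos_of_mem_ball ha]
  have hsub : ball p (R / 5) ⊆ ball p R := ball_subset_ball (by linarith)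
  -- Schottky's theorem applies to `1/h` around a point `q` where `‖h q‖ = ε` exactly. Since `a` is
  -- within `2R/5` of `q`, it keeps `h a` away from `0`.
  obtain ⟨q, hq, hqe⟩ := (convex_ball p (R / 5)).isPreconnected.intermediate_value ha hb
    ((hd.continuousOn.mono hsub).norm) ⟨(hlt.trans_le (min_le_left _ _)).le, hge⟩
  have hq5 : ball q (4 * R / 5) ⊆ ball p R := fun x hx => by
    rw [mem_ball] at hx hq ⊢
    linarith [dist_triangle x q p]
  have := hM (fun z => (h z)⁻¹) q (4 * R / 5) (by linarith) ((hd.mono hq5).inv fun z hz => h0 z (hq5 hz))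
    (fun z hz => inv_ne_zero (h0 z (hq5 hz)))
    (fun z hz => by rw [Ne, inv_eq_one]; exact h1 z (hq5 hz))
    (by simp only [norm_inv]; rw [show ‖h q‖ = ε from hqe])
    a (by
      rw [mem_ball] at ha hq
      rw [mem_closedBall]
      linarith [dist_triangle_right a q p])
  rw [norm_inv] at this
  have hpos : 0 < ‖h a‖ := norm_pos_iff.2 (h0 a (hsub ha))
  have h2 := inv_lt_of_inv_lt₀ hpos (this.trans_lt ((le_abs_self M).trans_lt (lt_add_one _)))
  exact (h2.trans (hlt.trans_le (min_le_right _ _))).false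

/-! ### Path lifting through local homeomorphisms -/

section PathLifting

variable {E X : Type*} [TopologicalSpace E] {p : E → X}

/-- `Γ` is a lift through `p` of the path `γ`, over the parameter interval `[0, t]`, with initial
point `e`. -/
def IsLiftUpTo (p : E → X) (γ : ℝ → X) (e : E) (t : ℝ) (Γ : ℝ → E) : Prop :=
  ContinuousOn Γ (Icc 0 t) ∧ Γ 0 = e ∧ ∀ s ∈ Icc 0 t, p (Γ s) = γ s

theorem IsLiftUpTo.mono {γ : ℝ → X} {e : E} {s t : ℝ} {Γ : ℝ → E} (h : IsLiftUpTo p γ e t Γ)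
    (hst : s ≤ t) : IsLiftUpTo p γ e s Γ :=
  ⟨h.1.mono (Icc_subset_Icc_right hst), h.2.1, fun u hu => h.2.2 u (Icc_subset_Icc_right hst hu)⟩

variable [TopologicalSpace X]

theorem IsLiftUpTo.eqOn [T2Space E] (hp : IsLocalHomeomorph p) {γ : ℝ → X} {e : E} {t : ℝ}
    {Γ Γ' : ℝ → E} (h : IsLiftUpTo p γ e t Γ) (h' : IsLiftUpTo p γ e t Γ') :
    EqOn Γ Γ' (Icc 0 t) := by
  rcases lt_or_ge t 0 with ht | ht
  · simp [Icc_eq_empty ht.not_ge, EqOn]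
  · exact (T2Space.isSeparatedMap p).eqOn_of_comp_eqOn hp.isLocallyInjective isPreconnected_Icc
      h.1 h'.1 (fun s hs => (h.2.2 s hs).trans (h'.2.2 s hs).symm) (left_mem_Icc.2 ht)
      (h.2.1.trans h'.2.1.symm)

/-- A lift can be continued as long as the path stays in the target of a local inverse. -/
theorem IsLiftUpTo.extend {γ : ℝ → X} {e : E} {s t : ℝ} {Γ : ℝ → E} (h : IsLiftUpTo p γ e s Γ)
    (hs : 0 ≤ s) (q : OpenPartialHomeomorph E X) (hq : p = q) (hΓ : Γ s ∈ q.source)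
    (hγ : ContinuousOn γ (Icc s t)) (hγq : MapsTo γ (Icc s t) q.target) :
    ∃ Γ', IsLiftUpTo p γ e t Γ' := by
  refine ⟨fun u => if u ≤ s then Γ u else q.symm (γ u), ?_, ?_, fun u hu => ?_⟩
  · refine ContinuousOn.if (fun u hu => ?_) (h.1.mono fun u hu => ?_) ?_
    · have hus : u = s := frontier_le_subset_eq continuous_id continuous_const hu.2
      rw [hus, ← h.2.2 s (right_mem_Icc.2 hs), hq, q.left_inv hΓ]
    · exact ⟨hu.1.1, (closure_le_eq continuous_id continuous_const).subset hu.2⟩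
    · have hsub : Icc 0 t ∩ closure {u | ¬ u ≤ s} ⊆ Icc s t := fun u hu => by
        simp only [not_le] at hu
        exact ⟨closure_lt_subset_le continuous_const continuous_id hu.2, hu.1.2⟩
      exact q.continuousOn_symm.comp (hγ.mono hsub) (hγq.mono_left hsub)
  · simp only [if_pos hs, h.2.1]
  · by_cases hus : u ≤ s
    · simp only [if_pos hus, h.2.2 u ⟨hu.1, hus⟩]
    · have := hγq ⟨(not_le.1 hus).le, hu.2⟩
      simp only [if_neg hus]
      rw [hq, q.right_inv this]

/-- A path can be lifted through a local homeomorphism if each lift over a half-open interval has a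
limit at the right endpoint. -/
theorem exists_isLiftUpTo_one [T2Space E] [T2Space X] (hp : IsLocalHomeomorph p) {γ : ℝ → X}
    (hγ : Continuous γ) {e : E} (he : p e = γ 0)
    (H : ∀ t > 0, ∀ Γ : ℝ → E, ContinuousOn Γ (Ico 0 t) → (∀ s ∈ Ico 0 t, p (Γ s) = γ s) →
      ∃ x, Tendsto Γ (𝓝[<] t) (𝓝 x)) :
    ∃ Γ, IsLiftUpTo p γ e 1 Γ := by
  by_contra hno
  set T : Set ℝ := {t | 0 ≤ t ∧ ∃ Γ, IsLiftUpTo p γ e t Γ} with hT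
  have h0 : (0 : ℝ) ∈ T := ⟨le_rfl, fun _ => e, continuousOn_const, rfl, fun s hs => by
    rw [Icc_self, mem_singleton_iff] at hs
    rw [hs, he]⟩
  have hlt : ∀ t ∈ T, t < 1 := fun t ht => by
    by_contra! h
    obtain ⟨Γ, hΓ⟩ := ht.2
    exact hno ⟨Γ, hΓ.mono h⟩
  have hbdd : BddAbove T := ⟨1, fun t ht => (hlt t ht).le⟩
  set τ := sSup T with hτ
  -- A local inverse defined along `γ` on `[s, τ]` is defined slightly beyond `τ`, so it would
  -- extend the lift past the supremum.
  have hstep : ∀ s ∈ T, ∀ Γ, IsLiftUpTo p γ e s Γ → ∀ q : OpenPartialHomeomorph E X,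
      p = q → Γ s ∈ q.source → (∀ u ∈ Icc s τ, γ u ∈ q.target) → False := by
    intro s hs Γ hΓ q hq hsq hu
    have hsτ : s ≤ τ := le_csSup hbdd hs
    have hτq : γ τ ∈ q.target := hu τ (right_mem_Icc.2 hsτ)
    obtain ⟨δ, hδ, hδq⟩ := Metric.mem_nhds_iff.1
      (hγ.continuousAt.preimage_mem_nhds (q.open_target.mem_nhds hτq))
    have hmem : τ + δ / 2 ∈ T := by
      refine ⟨by linarith [hs.1], hΓ.extend hs.1 q hq hsq hγ.continuousOn fun u hu' => ?_⟩
      rcases le_total u τ with h | h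
      · exact hu u ⟨hu'.1, h⟩
      · refine hδq ?_
        rw [Metric.mem_ball, Real.dist_eq, abs_of_nonneg (by linarith)]
        linarith [hu'.2]
    linarith [le_csSup hbdd hmem]
  have hτ0 : 0 ≤ τ := le_csSup hbdd h0
  rcases hτ0.eq_or_lt with hτ0 | hτ0
  · obtain ⟨q, hxq, hq⟩ := hp e
    obtain ⟨Γ, hΓ⟩ := h0.2
    refine hstep 0 h0 Γ hΓ q hq (by rwa [hΓ.2.1]) fun u hu => ?_
    rw [← hτ0, Icc_self, mem_singleton_iff] at hu
    rw [hu, ← he, hq]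
    exact q.map_source hxq
  have hdown : ∀ s ∈ Ico 0 τ, ∃ Γ, IsLiftUpTo p γ e s Γ := fun s hs => by
    obtain ⟨t, ht, hst⟩ := exists_lt_of_lt_csSup ⟨0, h0⟩ hs.2
    obtain ⟨Γ, hΓ⟩ := ht.2
    exact ⟨Γ, hΓ.mono hst.le⟩
  have : Nonempty E := ⟨e⟩
  choose! G hG using hdown
  -- By uniqueness the chosen lifts agree, so the diagonal `s ↦ G s s` is one lift over `[0, τ)`.
  have hGeq : ∀ t ∈ Ico 0 τ, EqOn (fun s => G s s) (G t) (Icc 0 t) := fun t ht s hs =>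
    (hG s ⟨hs.1, hs.2.trans_lt ht.2⟩).eqOn hp ((hG t ht).mono hs.2) (right_mem_Icc.2 hs.1)
  have hcont : ContinuousOn (fun s => G s s) (Ico 0 τ) := fun s hs => by
    obtain ⟨t, hst, htτ⟩ := exists_between hs.2
    have ht : t ∈ Ico 0 τ := ⟨hs.1.trans hst.le, htτ⟩
    have h1 := ((hG t ht).1.congr (hGeq t ht)) s ⟨hs.1, hst.le⟩
    refine h1.mono_of_mem_nhdsWithin ?_
    filter_upwards [self_mem_nhdsWithin, mem_nhdsWithin_of_mem_nhds (Iio_mem_nhds hst)] with u h2 h3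
    exact ⟨h2.1, h3.le⟩
  have hlift : ∀ s ∈ Ico 0 τ, p (G s s) = γ s := fun s hs => (hG s hs).2.2 s (right_mem_Icc.2 hs.1)
  obtain ⟨x, hx⟩ := H τ hτ0 _ hcont hlift
  have hpx : p x = γ τ := by
    have h1 : Tendsto (fun s => p (G s s)) (𝓝[<] τ) (𝓝 (p x)) := (hp.continuous.tendsto x).comp hx
    have h2 : Tendsto γ (𝓝[<] τ) (𝓝 (γ τ)) := hγ.continuousAt.mono_left nhdsWithin_le_nhds
    refine tendsto_nhds_unique (h1.congr' ?_) h2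
    filter_upwards [Ico_mem_nhdsLT hτ0] with s hs using hlift s hs
  obtain ⟨q, hxq, hq⟩ := hp x
  have hτq : γ τ ∈ q.target := by
    rw [← hpx, hq]
    exact q.map_source hxq
  obtain ⟨δ, hδ, hδq⟩ := Metric.mem_nhds_iff.1
      (hγ.continuousAt.preimage_mem_nhds (q.open_target.mem_nhds hτq))
  have hev : ∀ᶠ s in 𝓝[<] τ, s ∈ Ico 0 τ ∧ G s s ∈ q.source ∧ τ - δ < s := by
    filter_upwards [Ico_mem_nhdsLT hτ0, hx.eventually (q.open_source.mem_nhds hxq),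
      mem_nhdsWithin_of_mem_nhds (Ioi_mem_nhds (show τ - δ < τ by linarith))] with s h1 h2 h3
    exact ⟨h1, h2, h3⟩
  obtain ⟨s, hs, hsq, hsδ⟩ := hev.exists
  refine hstep s ⟨hs.1, _, hG s hs⟩ _ (hG s hs) q hq hsq fun u hu => hδq ?_
  rw [Metric.mem_ball, Real.dist_eq, abs_of_nonpos (by linarith [hu.2])]
  linarith [hu.1]

end PathLifting

/-! ### Lifting through an entire function off its singular values -/

section EntireLifting

variable {f : ℂ → ℂ}

theorem deriv_ne_zero_of_notMem_singularValues {w : ℂ} (hw : f w ∉ singularValues f) :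
    deriv f w ≠ 0 := fun h =>
  hw (subset_closure (Or.inl ⟨w, h, rfl⟩))

/-- Discarding the preimage of `S(f)` removes all critical points, and what remains is open because
`S(f)` is closed. -/
theorem isLocalHomeomorph_comp_val (hf : Differentiable ℂ f) :
    IsLocalHomeomorph (f ∘ ((↑) : {x // f x ∉ singularValues f} → ℂ)) := by
  have hopen : IsOpen {x | f x ∉ singularValues f} :=
    (isClosed_closure.isOpen_compl).preimage hf.continuous
  have h1 : IsLocalHomeomorphOn f {x | f x ∉ singularValues f} := by
    refine IsLocalHomeomorphOn.mk f _ fun x hx => ?_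
    have hs := (hf.analyticAt x).hasStrictDerivAt
    refine ⟨(hs.hasStrictFDerivAt_equiv (deriv_ne_zero_of_notMem_singularValues hx)
      ).toOpenPartialHomeomorph f, HasStrictFDerivAt.mem_toOpenPartialHomeomorph_source _, ?_⟩
    exact fun _ _ => rfl
  have h2 : IsLocalHomeomorph ((↑) : {x // f x ∉ singularValues f} → ℂ) :=
    hopen.isOpenEmbedding_subtypeVal.isLocalHomeomorph
  exact isLocalHomeomorph_iff_isLocalHomeomorphOn_univ.2
    (h1.comp h2.isLocalHomeomorphOn fun x _ => x.2)

/-- A lift of a convergent path cannot tend to infinity if the limit is not an asymptotic value. -/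
theorem not_tendsto_cocompact_of_notMem_asymptoticValues {t : ℝ} (ht : 0 < t) {a : ℂ}
    (ha : a ∉ asymptoticValues f) {Γ : ℝ → ℂ} (hΓ : ContinuousOn Γ (Ico 0 t))
    (hlim : Tendsto (fun s => f (Γ s)) (𝓝[<] t) (𝓝 a)) : ¬ Tendsto Γ (𝓝[<] t) (cocompact ℂ) := by
  intro hinf
  -- Asymptotic paths are parametrised by `[0, ∞)`; `σ` carries that ray to `[0, t)`.
  set σ : ℝ → ℝ := fun u => t - t * (1 + u)⁻¹ with hσ
  have hσc : ContinuousOn σ (Ici 0) := by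
    refine continuousOn_const.sub (continuousOn_const.mul (ContinuousOn.inv₀ (by fun_prop) ?_))
    intro u hu
    have : (0 : ℝ) ≤ u := hu
    positivity
  have hσm : ∀ u ∈ Ici (0 : ℝ), σ u ∈ Ico 0 t := fun u hu => by
    have hu' : (0 : ℝ) ≤ u := hu
    have h1 : 0 < (1 + u)⁻¹ := by positivity
    have h2 : (1 + u)⁻¹ ≤ 1 := inv_le_one_of_one_le₀ (by linarith)
    constructor <;> simp only [hσ] <;> nlinarith
  have hσt : Tendsto σ atTop (𝓝[<] t) := by
    refine tendsto_nhdsWithin_iff.2 ⟨?_, ?_⟩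
    · have h1 : Tendsto (fun u : ℝ => (1 + u)⁻¹) atTop (𝓝 0) :=
        tendsto_inv_atTop_zero.comp (tendsto_atTop_add_const_left _ _ tendsto_id)
      simpa [hσ] using (h1.const_mul t).const_sub t
    · filter_upwards [Ici_mem_atTop 0] with u hu using (hσm u hu).2
  exact ha ⟨Γ ∘ σ, hΓ.comp hσc hσm, hinf.comp hσt, hlim.comp hσt⟩

/-- A lift through an entire function of a path that converges to a non-singular value converges. -/
theorem exists_tendsto_of_lift (hf : Differentiable ℂ f) {t : ℝ} (ht : 0 < t) {a : ℂ}
    (ha : a ∉ singularValues f) {Γ : ℝ → ℂ} (hΓ : ContinuousOn Γ (Ico 0 t))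
    (hlim : Tendsto (fun s => f (Γ s)) (𝓝[<] t) (𝓝 a)) :
    ∃ x, f x = a ∧ Tendsto Γ (𝓝[<] t) (𝓝 x) := by
  have hnot := not_tendsto_cocompact_of_notMem_asymptoticValues ht
    (fun h => ha (subset_closure (Or.inr h))) hΓ hlim
  obtain ⟨K, hK, hfreq⟩ : ∃ K : Set ℂ, IsCompact K ∧ ∃ᶠ s in 𝓝[<] t, Γ s ∈ K := by
    simp only [(hasBasis_cocompact).tendsto_right_iff, not_forall] at hnot
    obtain ⟨K, hK, h⟩ := hnot
    refine ⟨K, hK, ?_⟩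
    simpa only [Filter.Frequently, mem_compl_iff] using h
  obtain ⟨x, -, hx⟩ := hK.exists_mapClusterPt_of_frequently hfreq
  have hfx : f x = a := by
    have h1 : MapClusterPt (f x) (𝓝[<] t) (f ∘ Γ) := hx.continuousAt_comp hf.continuous.continuousAt
    exact eq_of_nhds_neBot (h1.clusterPt.mono hlim)
  refine ⟨x, hfx, Metric.tendsto_nhds.2 fun ε hε => ?_⟩
  -- The cluster point `x` is an isolated preimage of `a`, so a small circle around it misses
  -- `f⁻¹(a)`. Once `f ∘ Γ` is close to `a`, `Γ` cannot cross that circle and stays inside.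
  have hne := (hf x).hasDerivAt.eventually_ne (c := a)
    (deriv_ne_zero_of_notMem_singularValues (by rwa [hfx]))
  obtain ⟨δ, hδ, hδne⟩ := Metric.mem_nhdsWithin_iff.1 hne
  obtain ⟨ρ, hρ, hρlt⟩ := exists_between (lt_min hε hδ)
  have hsph : ∀ y ∈ Metric.sphere x ρ, f y ≠ a := fun y hy => by
    rw [Metric.mem_sphere] at hy
    refine hδne ⟨?_, ?_⟩
    · rw [Metric.mem_ball, hy]; exact hρlt.trans_le (min_le_right _ _)
    · rintro rfl
      rw [dist_self] at hy
      exact hρ.ne hy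
  have hcomp : IsCompact (f '' Metric.sphere x ρ) := (isCompact_sphere x ρ).image hf.continuous
  have hev : ∀ᶠ s in 𝓝[<] t, f (Γ s) ∉ f '' Metric.sphere x ρ := by
    refine hlim.eventually (hcomp.isClosed.isOpen_compl.mem_nhds ?_)
    rintro ⟨y, hy, hya⟩
    exact hsph y hy hya
  obtain ⟨u, hu, hIoo⟩ := mem_nhdsLT_iff_exists_Ioo_subset.1
    (hev.and (Ico_mem_nhdsLT ht : ∀ᶠ s in 𝓝[<] t, s ∈ Ico 0 t))
  have hnear := (hx.frequently (Metric.ball_mem_nhds x hρ)).and_eventually (Ioo_mem_nhdsLT hu)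
  obtain ⟨s₀, hs₀, hs₀u⟩ := hnear.exists
  filter_upwards [Ioo_mem_nhdsLT hu] with s hs
  refine lt_of_lt_of_le ?_ (hρlt.le.trans (min_le_left _ _))
  by_contra! hge
  have hc : ContinuousOn (fun s => dist (Γ s) x) (Ioo u t) :=
    (continuous_id.dist continuous_const).comp_continuousOn (hΓ.mono fun v hv => (hIoo hv).2)
  obtain ⟨v, hv, hve⟩ := isPreconnected_Ioo.intermediate_value hs₀u hs hc
    ⟨(Metric.mem_ball.1 hs₀).le, hge⟩
  exact (hIoo hv).1 ⟨Γ v, hve, rfl⟩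

/-- Paths avoiding the singular values lift through an entire function. -/
theorem exists_isLiftUpTo_one_of_differentiable (hf : Differentiable ℂ f) {γ : ℝ → ℂ}
    (hγ : Continuous γ) (hγS : ∀ t, γ t ∉ singularValues f)
    (e : {x // f x ∉ singularValues f}) (he : f e = γ 0) :
    ∃ Γ, IsLiftUpTo (f ∘ ((↑) : {x // f x ∉ singularValues f} → ℂ)) γ e 1 Γ := by
  refine exists_isLiftUpTo_one (isLocalHomeomorph_comp_val hf) hγ he fun t ht Γ hΓ hl => ?_
  have h1 : Tendsto γ (𝓝[<] t) (𝓝 (γ t)) := hγ.continuousAt.mono_left nhdsWithin_le_nhds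
  obtain ⟨x, hx, hlim⟩ := exists_tendsto_of_lift hf ht (hγS t) (Γ := fun s => (Γ s : ℂ))
    (continuous_subtype_val.comp_continuousOn hΓ) (h1.congr' (by
      filter_upwards [Ico_mem_nhdsLT ht] with s hs using (hl s hs).symm))
  exact ⟨⟨x, by rw [hx]; exact hγS t⟩, tendsto_subtype_rng.2 hlim⟩

open Metric in
/-- Holomorphic maps from a disc to the complement of the singular values lift through `f`. -/
theorem exists_holomorphic_lift (hf : Differentiable ℂ f) {g : ℂ → ℂ} {c : ℂ} {r : ℝ}
    (hg : DifferentiableOn ℂ g (ball c r)) (hgS : ∀ z ∈ ball c r, g z ∉ singularValues f) {a w : ℂ}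
    (ha : a ∈ ball c r) (hw : f w = g a) :
    ∃ φ : ℂ → ℂ, DifferentiableOn ℂ φ (ball c r) ∧ φ a = w ∧ ∀ z ∈ ball c r, f (φ z) = g z := by
  have hp := isLocalHomeomorph_comp_val hf
  let e : {x // f x ∉ singularValues f} := ⟨w, by rw [hw]; exact hgS a ha⟩
  have hseg : ∀ (t : unitInterval) (z : ball c r), a + (t : ℝ) • ((z : ℂ) - a) ∈ ball c r :=
    fun t z => (convex_ball c r).add_smul_sub_mem ha z.2 t.2
  have hgc : Continuous fun z : ball c r => g z := hg.continuousOn.domRestrict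
  -- The image under `g` of the segment from `a` to `z` is lifted, and `φ z` is the endpoint of the
  -- lift.
  let F : C(unitInterval × ball c r, ℂ) :=
    ⟨fun x => g (a + (x.1 : ℝ) • ((x.2 : ℂ) - a)), hgc.comp
      (g := fun z : ball c r => g z) (f := fun x : unitInterval × ball c r =>
        (⟨a + (x.1 : ℝ) • ((x.2 : ℂ) - a), hseg x.1 x.2⟩ : ball c r)) (by fun_prop)⟩
  have hlift : ∀ z : ball c r, ∃ Γ : unitInterval → {x // f x ∉ singularValues f},
      Continuous Γ ∧ Γ 0 = e ∧ ∀ t, f (Γ t) = F (t, z) := fun z => by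
    obtain ⟨Γ, hΓ⟩ := exists_isLiftUpTo_one_of_differentiable hf
      (γ := fun s => F (projIcc 0 1 zero_le_one s, z)) (by fun_prop)
      (fun s => hgS _ (hseg _ z)) e (by
        change f w = g _
        simp [hw])
    refine ⟨fun t => Γ t, hΓ.1.comp_continuous continuous_subtype_val fun t => t.2, hΓ.2.1,
      fun t => ?_⟩
    have := hΓ.2.2 t t.2
    simpa [projIcc_val] using this
  choose Γ hΓc hΓ0 hΓl using hlift
  have hcont : Continuous fun x : unitInterval × ball c r => Γ x.2 x.1 :=
    hp.continuous_lift (T2Space.isSeparatedMap _) F (funext fun x => hΓl x.2 x.1)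
      (by simp only [hΓ0]; exact continuous_const) hΓc
  classical
  let φ : ℂ → ℂ := fun z => if h : z ∈ ball c r then Γ ⟨z, h⟩ 1 else 0
  have hφ : ∀ z : ball c r, φ z = Γ z 1 := fun z => dif_pos z.2
  have hφc : ContinuousOn φ (ball c r) := by
    rw [continuousOn_iff_continuous_domRestrict]
    have : (ball c r).domRestrict φ = fun z => ((Γ z 1 : {x // f x ∉ singularValues f}) : ℂ) :=
      funext fun z => hφ z
    rw [this]
    exact continuous_subtype_val.comp (hcont.comp (Continuous.prodMk_right 1))
  have hφl : ∀ z ∈ ball c r, f (φ z) = g z := fun z hz => by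
    rw [hφ ⟨z, hz⟩, hΓl]
    change g _ = g z
    simp
  refine ⟨φ, fun z hz => ?_, ?_, hφl⟩
  · have hd : deriv f (φ z) ≠ 0 :=
      deriv_ne_zero_of_notMem_singularValues (by rw [hφl z hz]; exact hgS z hz)
    have hs : HasStrictDerivAt f (deriv f (φ z)) (φ z) := (hf.analyticAt _).hasStrictDerivAt
    have hat : ContinuousAt φ z := hφc.continuousAt (isOpen_ball.mem_nhds hz)
    have hinv := (hs.to_localInverse hd).hasDerivAt.differentiableAt
    rw [hφl z hz] at hinv
    have hcomp := hinv.comp z (hg.differentiableAt (isOpen_ball.mem_nhds hz))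
    refine (hcomp.congr_of_eventuallyEq ?_).differentiableWithinAt
    filter_upwards [hat.eventually (hs.eventually_left_inverse hd), isOpen_ball.mem_nhds hz]
      with x hx hxb
    rw [Function.comp_apply, ← hφl x hxb]
    exact hx.symm
  -- For `z = a` the path is constant, hence so is its lift.
  · have := (T2Space.isSeparatedMap _).const_of_comp hp.isLocallyInjective (hΓc ⟨a, ha⟩)
      (fun t t' => by
        change f _ = f _
        rw [hΓl, hΓl]
        change g _ = g _
        simp) 1 0
    rw [hφ ⟨a, ha⟩, this, hΓ0]

end EntireLifting

/-! ### Grand orbits as equivalence classes -/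

section GrandOrbit

variable {f : ℂ → ℂ}

theorem mem_grandOrbit_self (f : ℂ → ℂ) (z : ℂ) : z ∈ grandOrbit f z := ⟨0, 0, rfl⟩

theorem mem_grandOrbit_comm {z w : ℂ} : w ∈ grandOrbit f z ↔ z ∈ grandOrbit f w :=
  ⟨fun ⟨n, m, h⟩ => ⟨m, n, h.symm⟩, fun ⟨n, m, h⟩ => ⟨m, n, h.symm⟩⟩

theorem mem_grandOrbit_trans {z w u : ℂ} (hw : w ∈ grandOrbit f z) (hu : u ∈ grandOrbit f w) :
    u ∈ grandOrbit f z := by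
  obtain ⟨n, m, h⟩ := hw
  obtain ⟨a, b, h'⟩ := hu
  refine ⟨a + n, m + b, ?_⟩
  rw [Function.iterate_add_apply, h, Function.iterate_add_apply, ← h',
    ← Function.iterate_add_apply, ← Function.iterate_add_apply, add_comm]

theorem grandOrbit_eq_of_mem {z w : ℂ} (h : w ∈ grandOrbit f z) :
    grandOrbit f w = grandOrbit f z :=
  Subset.antisymm (fun _ hu => mem_grandOrbit_trans h hu)
    fun _ hu => mem_grandOrbit_trans (mem_grandOrbit_comm.1 h) hu

theorem iterate_mem_grandOrbit (f : ℂ → ℂ) (n : ℕ) (z : ℂ) : f^[n] z ∈ grandOrbit f z :=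
  ⟨n, 0, rfl⟩

theorem mem_grandOrbit_of_iterate_mem {z w : ℂ} {n : ℕ} (h : f^[n] w ∈ grandOrbit f z) :
    w ∈ grandOrbit f z :=
  mem_grandOrbit_trans h (mem_grandOrbit_comm.1 (iterate_mem_grandOrbit f n w))

theorem mem_grandOrbitSet {A : Set ℂ} {w : ℂ} :
    w ∈ grandOrbitSet f A ↔ ∃ z ∈ A, w ∈ grandOrbit f z := by
  simp [grandOrbitSet]

theorem mem_grandOrbitSet_of_mem_grandOrbit {A : Set ℂ} {w u : ℂ} (hw : w ∈ grandOrbitSet f A)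
    (hu : u ∈ grandOrbit f w) : u ∈ grandOrbitSet f A := by
  obtain ⟨z, hz, hzw⟩ := mem_grandOrbitSet.1 hw
  exact mem_grandOrbitSet.2 ⟨z, hz, mem_grandOrbit_trans hzw hu⟩

end GrandOrbit

/-! ### Invariance of the marked Fatou set -/

section MarkedFatou

variable {f : ℂ → ℂ}

theorem isOpen_markedFatou (f : ℂ → ℂ) : IsOpen (markedFatou f) := isClosed_closure.isOpen_compl

theorem notMem_grandOrbitSet_of_mem_markedFatou {z : ℂ} (hz : z ∈ markedFatou f) :
    z ∉ grandOrbitSet f (singularValues f ∪ Function.periodicPts f) :=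
  fun h => hz (subset_closure h)

theorem apply_notMem_singularValues {z : ℂ} (hz : z ∈ markedFatou f) :
    f z ∉ singularValues f := fun h =>
  notMem_grandOrbitSet_of_mem_markedFatou hz (mem_grandOrbitSet.2 ⟨f z, Or.inl h, 0, 1, rfl⟩)

theorem mem_markedFatou_iff_eventually {z : ℂ} : z ∈ markedFatou f ↔
    ∀ᶠ w in 𝓝 z, w ∉ grandOrbitSet f (singularValues f ∪ Function.periodicPts f) := by
  rw [markedFatou, markedJulia, mem_compl_iff, mem_closure_iff_frequently, not_frequently]

theorem apply_mem_grandOrbitSet_iff {A : Set ℂ} {z : ℂ} :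
    f z ∈ grandOrbitSet f A ↔ z ∈ grandOrbitSet f A :=
  ⟨fun h => mem_grandOrbitSet_of_mem_grandOrbit h ⟨0, 1, rfl⟩,
    fun h => mem_grandOrbitSet_of_mem_grandOrbit h ⟨1, 0, rfl⟩⟩

/-- Pulling back uses continuity of `f`; pushing forward uses that `f` is open at `z`, where its
derivative does not vanish. -/
theorem apply_mem_markedFatou_iff (hf : Differentiable ℂ f) {z : ℂ} :
    f z ∈ markedFatou f ↔ z ∈ markedFatou f := by
  constructor
  · intro h
    rw [mem_markedFatou_iff_eventually] at h ⊢
    filter_upwards [hf.continuous.continuousAt.eventually h] with w hw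
    rwa [apply_mem_grandOrbitSet_iff] at hw
  · intro h
    have hs : HasStrictDerivAt f (deriv f z) z := (hf.analyticAt z).hasStrictDerivAt
    have hd := deriv_ne_zero_of_notMem_singularValues (apply_notMem_singularValues h)
    rw [mem_markedFatou_iff_eventually] at h ⊢
    rw [← hs.map_nhds_eq hd, eventually_map]
    filter_upwards [h] with w hw
    rwa [apply_mem_grandOrbitSet_iff]

theorem iterate_mem_markedFatou_iff (hf : Differentiable ℂ f) (n : ℕ) {z : ℂ} :
    f^[n] z ∈ markedFatou f ↔ z ∈ markedFatou f := by
  induction n with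
  | zero => rfl
  | succ n ih => rw [Function.iterate_succ_apply', apply_mem_markedFatou_iff hf, ih]

theorem mem_markedFatou_of_mem_grandOrbit (hf : Differentiable ℂ f) {z w : ℂ}
    (hz : z ∈ markedFatou f) (hw : w ∈ grandOrbit f z) : w ∈ markedFatou f := by
  obtain ⟨n, m, h⟩ := hw
  rwa [← iterate_mem_markedFatou_iff hf m, ← h, iterate_mem_markedFatou_iff hf]

theorem deriv_iterate_ne_zero (hf : Differentiable ℂ f) (n : ℕ) {z : ℂ} (hz : z ∈ markedFatou f) :
    deriv f^[n] z ≠ 0 := by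
  induction n with
  | zero => simp
  | succ n ih =>
    rw [Function.iterate_succ', deriv_comp z (hf _) (hf.iterate n z)]
    exact mul_ne_zero (deriv_ne_zero_of_notMem_singularValues
      (apply_notMem_singularValues ((iterate_mem_markedFatou_iff hf n).2 hz))) ih

theorem hasStrictDerivAt_iterate (hf : Differentiable ℂ f) (n : ℕ) (z : ℂ) :
    HasStrictDerivAt f^[n] (deriv f^[n] z) z :=
  ((hf.iterate n).analyticAt z).hasStrictDerivAt

theorem map_iterate_nhds (hf : Differentiable ℂ f) (n : ℕ) {z : ℂ} (hz : z ∈ markedFatou f) :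
    map f^[n] (𝓝 z) = 𝓝 (f^[n] z) :=
  (hasStrictDerivAt_iterate hf n z).map_nhds_eq (deriv_iterate_ne_zero hf n hz)

/-- A coincidence would make some iterate of `z` periodic. This is what rigidly ties together the
exponents of two orbit branches. -/
theorem iterate_injective_of_mem_markedFatou {z : ℂ} (hz : z ∈ markedFatou f) {a b : ℕ}
    (hab : f^[a] z = f^[b] z) : a = b := by
  by_contra hne
  wlog hlt : a < b generalizing a b
  · exact this hab.symm (Ne.symm hne) (lt_of_le_of_ne (not_lt.1 hlt) (Ne.symm hne))
  refine notMem_grandOrbitSet_of_mem_markedFatou hz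
    (mem_grandOrbitSet.2 ⟨f^[a] z, Or.inr ?_, 0, a, rfl⟩)
  refine Function.mk_mem_periodicPts (Nat.sub_pos_of_lt hlt) ?_
  rw [Function.IsPeriodicPt, Function.IsFixedPt, ← Function.iterate_add_apply,
    Nat.sub_add_cancel hlt.le, hab]

/-- The grand orbit of an open subset of the marked Fatou set is open. -/
theorem grandOrbitSet_mem_nhds (hf : Differentiable ℂ f) {C : Set ℂ} (hC : IsOpen C)
    (hCF : C ⊆ markedFatou f) {z : ℂ} (hz : z ∈ grandOrbitSet f C) : grandOrbitSet f C ∈ 𝓝 z := by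
  obtain ⟨c, hc, n, m, h⟩ := mem_grandOrbitSet.1 hz
  have h1 : f^[n] '' C ∈ 𝓝 (f^[m] z) := by
    rw [← h, ← map_iterate_nhds hf n (hCF hc)]
    exact image_mem_map (hC.mem_nhds hc)
  filter_upwards [(hf.iterate m).continuous.continuousAt.preimage_mem_nhds h1] with w hw
  obtain ⟨d, hd, hdw⟩ := hw
  exact mem_grandOrbitSet.2 ⟨d, hd, n, m, hdw⟩

/-- Accumulation of a grand orbit at one of its points is a property of the grand orbit. -/
theorem accPt_grandOrbit_of_mem (hf : Differentiable ℂ f) {z w : ℂ} (hz : z ∈ markedFatou f)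
    (h : AccPt z (𝓟 (grandOrbit f z))) (hw : w ∈ grandOrbit f z) :
    AccPt w (𝓟 (grandOrbit f w)) := by
  have hwF := mem_markedFatou_of_mem_grandOrbit hf hz hw
  rw [grandOrbit_eq_of_mem hw]
  obtain ⟨n, m, hnm⟩ := hw
  rw [accPt_iff_nhds] at *
  intro U hU
  -- Accumulating points are pushed forward by `f^[n]` and pulled back to `U` through `f^[m]`; local
  -- injectivity of `f^[n]` at `z` keeps them distinct from `w`.
  have h1 : f^[m] '' U ∈ 𝓝 (f^[n] z) := by
    rw [hnm, ← map_iterate_nhds hf m hwF]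
    exact image_mem_map hU
  have h2 := (hf.iterate n).continuous.continuousAt.preimage_mem_nhds h1
  have h3 := ((hf.iterate n) z).hasDerivAt.eventually_ne (c := f^[n] z)
    (deriv_iterate_ne_zero hf n hz)
  obtain ⟨y, ⟨⟨hy1, hy2⟩, hyz⟩, hne⟩ := h _ (inter_mem h2 (mem_nhdsWithin_iff_eventually.1 h3))
  obtain ⟨x, hxU, hxy⟩ := hy1
  refine ⟨x, ⟨hxU, ?_⟩, ?_⟩
  · refine mem_grandOrbit_of_iterate_mem (n := m) ?_
    rw [hxy]
    exact mem_grandOrbit_trans hyz (iterate_mem_grandOrbit f n y)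
  · rintro rfl
    exact hy2 hne (by rw [← hxy, hnm])

end MarkedFatou

/-! ### Holomorphic branches of the grand orbit relation -/

section OrbitBranch

variable {f : ℂ → ℂ}

/-- `φ` is a holomorphic branch on `D` of the grand orbit relation. -/
def IsOrbitBranch (f : ℂ → ℂ) (D : Set ℂ) (φ : ℂ → ℂ) : Prop :=
  DifferentiableOn ℂ φ D ∧ ∃ n m : ℕ, ∀ z ∈ D, f^[n] z = f^[m] (φ z)

theorem isOrbitBranch_id (f : ℂ → ℂ) (D : Set ℂ) : IsOrbitBranch f D id :=
  ⟨differentiableOn_id, 0, 0, fun _ _ => rfl⟩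

theorem IsOrbitBranch.mem_grandOrbit {D : Set ℂ} {φ : ℂ → ℂ} (h : IsOrbitBranch f D φ) {z : ℂ}
    (hz : z ∈ D) : φ z ∈ grandOrbit f z := by
  obtain ⟨-, n, m, h⟩ := h
  exact ⟨n, m, h z hz⟩

-- One inverse branch of `f` is taken at a time; total invariance of the marked Fatou set keeps each
-- intermediate lift off `S(f)`.
open Metric in
theorem exists_holomorphic_lift_iterate (hf : Differentiable ℂ f) {c : ℂ} {r : ℝ} {a : ℂ}
    (ha : a ∈ ball c r) {g : ℂ → ℂ} (hg : DifferentiableOn ℂ g (ball c r))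
    (hgF : ∀ z ∈ ball c r, g z ∈ markedFatou f) (m : ℕ) : ∀ w, f^[m] w = g a →
    ∃ φ : ℂ → ℂ, DifferentiableOn ℂ φ (ball c r) ∧ φ a = w ∧
      ∀ z ∈ ball c r, f^[m] (φ z) = g z := by
  induction m with
  | zero => exact fun w hw => ⟨g, hg, hw.symm, fun _ _ => rfl⟩
  | succ m ih =>
    intro w hw
    obtain ⟨ψ, hψ, hψa, hψl⟩ := ih (f w) hw
    have hψF : ∀ z ∈ ball c r, ψ z ∈ markedFatou f := fun z hz => by
      rw [← iterate_mem_markedFatou_iff hf m, hψl z hz]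
      exact hgF z hz
    have hψS : ∀ z ∈ ball c r, ψ z ∉ singularValues f := fun z hz h =>
      notMem_grandOrbitSet_of_mem_markedFatou (hψF z hz)
        (mem_grandOrbitSet.2 ⟨_, Or.inl h, mem_grandOrbit_self f _⟩)
    obtain ⟨φ, hφ, hφa, hφl⟩ := exists_holomorphic_lift hf hψ hψS ha hψa.symm
    refine ⟨φ, hφ, hφa, fun z hz => ?_⟩
    rw [Function.iterate_succ_apply, hφl z hz, hψl z hz]

open Metric in
theorem exists_isOrbitBranch (hf : Differentiable ℂ f) {c : ℂ} {r : ℝ}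
    (hD : ball c r ⊆ markedFatou f) {a w : ℂ} (ha : a ∈ ball c r) (hw : w ∈ grandOrbit f a) :
    ∃ φ, IsOrbitBranch f (ball c r) φ ∧ φ a = w := by
  obtain ⟨n, m, h⟩ := hw
  obtain ⟨φ, hφ, hφa, hφl⟩ := exists_holomorphic_lift_iterate hf ha
    (hf.iterate n).differentiableOn (fun z hz => (iterate_mem_markedFatou_iff hf n).2 (hD hz))
    m w h.symm
  exact ⟨φ, ⟨hφ, n, m, fun z hz => (hφl z hz).symm⟩, hφa⟩

open Metric in
/-- Two branches of the grand orbit relation that meet are equal. -/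
theorem IsOrbitBranch.eqOn (hf : Differentiable ℂ f) {c : ℂ} {r : ℝ}
    (hD : ball c r ⊆ markedFatou f) {φ ψ : ℂ → ℂ} (hφ : IsOrbitBranch f (ball c r) φ)
    (hψ : IsOrbitBranch f (ball c r) ψ) {a : ℂ} (ha : a ∈ ball c r) (h : φ a = ψ a) :
    EqOn φ ψ (ball c r) := by
  have hφF := mem_markedFatou_of_mem_grandOrbit hf (hD ha) (hφ.mem_grandOrbit ha)
  obtain ⟨hφd, n₁, m₁, h₁⟩ := hφ
  obtain ⟨hψd, n₂, m₂, h₂⟩ := hψ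
  -- Both sides, as iteration counts, send `φ a` to `f^[n₁ + n₂] a`. With the exponents matched,
  -- `f^[m₁ + m₂]` takes equal values on `φ` and `ψ`; its local injectivity and the identity theorem
  -- finish.
  have hexp : m₁ + n₂ = m₂ + n₁ := by
    refine iterate_injective_of_mem_markedFatou hφF ?_
    rw [add_comm, Function.iterate_add_apply, ← h₁ a ha, ← Function.iterate_add_apply,
      add_comm n₂, Function.iterate_add_apply, h₂ a ha, h, ← Function.iterate_add_apply, add_comm]
  have hcomm : ∀ z ∈ ball c r, f^[m₁ + m₂] (φ z) = f^[m₁ + m₂] (ψ z) := fun z hz => by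
    rw [add_comm m₁, Function.iterate_add_apply, ← h₁ z hz, add_comm m₂, Function.iterate_add_apply,
      ← h₂ z hz, ← Function.iterate_add_apply, ← Function.iterate_add_apply, hexp]
  have hinj := (hasStrictDerivAt_iterate hf (m₁ + m₂) (φ a)).eventually_left_inverse
    (deriv_iterate_ne_zero hf _ hφF)
  have hba := isOpen_ball.mem_nhds ha
  have e1 := (hφd.continuousOn.continuousAt hba).eventually hinj
  have hψt : Tendsto ψ (𝓝 a) (𝓝 (φ a)) := by
    rw [h]
    exact hψd.continuousOn.continuousAt hba
  have e2 := hψt.eventually hinj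
  refine (hφd.analyticOnNhd isOpen_ball).eqOn_of_preconnected_of_eventuallyEq
    (hψd.analyticOnNhd isOpen_ball) (convex_ball c r).isPreconnected ha ?_
  filter_upwards [e1, e2, hba] with z h3 h4 hz
  rw [hcomm z hz] at h3
  exact h3.symm.trans h4

end OrbitBranch

/-! ### Local triviality versus accumulation -/

section Dichotomy

variable {f : ℂ → ℂ}

/-- The grand orbit relation is trivial near `z`. -/
def IsLocallyTrivialGrandOrbit (f : ℂ → ℂ) (z : ℂ) : Prop :=
  ∃ U ∈ 𝓝 z, ∀ z' ∈ U, grandOrbit f z' ∩ U = {z'}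

theorem IsLocallyTrivialGrandOrbit.not_accPt {z : ℂ} (h : IsLocallyTrivialGrandOrbit f z) :
    ¬ AccPt z (𝓟 (grandOrbit f z)) := by
  obtain ⟨U, hU, h⟩ := h
  intro hacc
  obtain ⟨y, ⟨hyU, hy⟩, hne⟩ := accPt_iff_nhds.1 hacc U hU
  have : y ∈ ({z} : Set ℂ) := by
    rw [← h z (mem_of_mem_nhds hU)]
    exact ⟨hy, hyU⟩
  exact hne this

theorem isOpen_setOf_isLocallyTrivialGrandOrbit (f : ℂ → ℂ) :
    IsOpen {z | IsLocallyTrivialGrandOrbit f z} := by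
  refine isOpen_iff_mem_nhds.2 fun z hz => ?_
  obtain ⟨U, hU, h⟩ := hz
  filter_upwards [eventually_mem_nhds_iff.2 hU] with w hw using ⟨U, hw, h⟩

-- The radius `r` of the domain of `φ` does not shrink with `ε`, which is what lets Schottky's
-- theorem act. A fixed point of `φ` would force `φ = id`.
open Metric in
theorem exists_isOrbitBranch_of_not_isLocallyTrivial (hf : Differentiable ℂ f) {c : ℂ} {r : ℝ}
    (hD : ball c r ⊆ markedFatou f) (hc : ¬ IsLocallyTrivialGrandOrbit f c) {ε : ℝ} (hε : 0 < ε)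
    (hεr : ε ≤ r) :
    ∃ φ, IsOrbitBranch f (ball c r) φ ∧ (∀ z ∈ ball c r, φ z ≠ z) ∧
      ∃ a ∈ ball c ε, φ a ∈ ball c ε := by
  simp only [IsLocallyTrivialGrandOrbit, not_exists, not_and, not_forall] at hc
  obtain ⟨a, ha, hne⟩ := hc (ball c ε) (ball_mem_nhds c hε)
  obtain ⟨w, ⟨hw, hwb⟩, hwa⟩ : ∃ w ∈ grandOrbit f a ∩ ball c ε, w ≠ a := by
    by_contra! hall
    exact hne (Subset.antisymm (fun w hw => hall w hw)
      (singleton_subset_iff.2 ⟨mem_grandOrbit_self f a, ha⟩))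
  have har : a ∈ ball c r := ball_subset_ball hεr ha
  obtain ⟨φ, hφ, rfl⟩ := exists_isOrbitBranch hf hD har hw
  exact ⟨φ, hφ, fun z hz h => hwa (hφ.eqOn hf hD (isOrbitBranch_id f _) hz h har), a, ha, hwb⟩

open Metric in
/-- If the grand orbit relation is not trivial near `c`, then all grand orbits accumulate at their
points near `c`. -/
theorem accPt_grandOrbit_of_not_isLocallyTrivial (hf : Differentiable ℂ f) {c : ℂ} {r : ℝ}
    (hD : ball c r ⊆ markedFatou f) (hc : ¬ IsLocallyTrivialGrandOrbit f c) {z : ℂ}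
    (hz : z ∈ ball c (r / 5)) : AccPt z (𝓟 (grandOrbit f z)) := by
  have hr : 0 < r := by linarith [pos_of_mem_ball hz]
  have hcD : c ∈ ball c r := mem_ball_self hr
  have hzD : z ∈ ball c r := ball_subset_ball (by linarith) hz
  obtain ⟨α, hα, hα0, -⟩ := exists_isOrbitBranch_of_not_isLocallyTrivial hf hD hc hr le_rfl
  refine accPt_iff_nhds.2 fun U hU => ?_
  obtain ⟨η, hη, hηU⟩ := Metric.mem_nhds_iff.1 hU
  have hαz : 0 < ‖α z - z‖ := norm_pos_iff.2 (sub_ne_zero.2 (hα0 z hzD))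
  have hαc : 0 < ‖α c - c‖ := norm_pos_iff.2 (sub_ne_zero.2 (hα0 c hcD))
  obtain ⟨δ, hδ, hsmall⟩ := exists_norm_lt_of_omits_zero_one (div_pos hη hαz)
  have hcont : ContinuousAt (fun x => ‖α x - x‖) c :=
    ((hα.1.continuousOn.continuousAt (isOpen_ball.mem_nhds hcD)).sub continuousAt_id).norm
  obtain ⟨κ, hκ, hκα⟩ := Metric.mem_nhds_iff.1
    (hcont.eventually (lt_mem_nhds (half_lt_self hαc)))
  set d := ‖α c - c‖ / 2 with hd
  -- Near `c` the denominator `‖α x - x‖` exceeds `d`. The bound `2ε < δd` makes the quotient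
  -- smaller than `δ` at `a`, and `2ε < d` makes `φ` differ from `α` there, hence everywhere.
  have hd0 : 0 < d := half_pos hαc
  obtain ⟨ε, hε, hεlt⟩ : ∃ ε > 0, ε < min (min κ (r / 5)) (min (d / 2) (δ * d / 2)) :=
    exists_between (by positivity)
  simp only [lt_min_iff] at hεlt
  obtain ⟨⟨hεκ, hεr⟩, hεd, hεδ⟩ := hεlt
  obtain ⟨φ, hφ, hφ0, a, ha, hφa⟩ :=
    exists_isOrbitBranch_of_not_isLocallyTrivial hf hD hc hε (by linarith)
  have haD : a ∈ ball c r := ball_subset_ball (by linarith) ha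
  have hda : d < ‖α a - a‖ := hκα (ball_subset_ball hεκ.le ha)
  have hφa2 : ‖φ a - a‖ < 2 * ε := by
    rw [← dist_eq_norm]
    rw [mem_ball] at ha hφa
    linarith [dist_triangle_right (φ a) a c]
  have hφα : ∀ x ∈ ball c r, φ x ≠ α x := fun x hx h => by
    have := hφ.eqOn hf hD hα hx h haD
    rw [this] at hφa2
    linarith
  have hα0' : ∀ x ∈ ball c r, α x - x ≠ 0 := fun x hx => sub_ne_zero.2 (hα0 x hx)
  have hlt := hsmall (fun x => (φ x - x) / (α x - x)) c r
    ((hφ.1.sub differentiableOn_id).div (hα.1.sub differentiableOn_id) hα0')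
    (fun x hx => div_ne_zero (sub_ne_zero.2 (hφ0 x hx)) (hα0' x hx))
    (fun x hx h => hφα x hx (sub_left_injective ((div_eq_one_iff_eq (hα0' x hx)).1 h)))
    a (ball_subset_ball hεr.le ha) z hz (by
      rw [norm_div, div_lt_iff₀ (hd0.trans hda)]
      nlinarith)
  rw [norm_div, div_lt_div_iff_of_pos_right hαz, ← dist_eq_norm] at hlt
  exact ⟨φ z, ⟨hηU hlt, hφ.mem_grandOrbit hzD⟩, hφ0 z hzD⟩

theorem isLocallyTrivial_iff_not_accPt (hf : Differentiable ℂ f) {z : ℂ} (hz : z ∈ markedFatou f) :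
    IsLocallyTrivialGrandOrbit f z ↔ ¬ AccPt z (𝓟 (grandOrbit f z)) := by
  refine ⟨fun h => h.not_accPt, fun h => ?_⟩
  by_contra hc
  obtain ⟨r, hr, hD⟩ := Metric.isOpen_iff.1 (isOpen_markedFatou f) z hz
  exact h (accPt_grandOrbit_of_not_isLocallyTrivial hf hD hc (Metric.mem_ball_self (by linarith)))

/-- Failure at the centre of a disc forces accumulation throughout the disc of one fifth the radius.
-/
theorem isOpen_setOf_mem_markedFatou_not_isLocallyTrivial (hf : Differentiable ℂ f) :
    IsOpen {z | z ∈ markedFatou f ∧ ¬ IsLocallyTrivialGrandOrbit f z} := by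
  refine isOpen_iff_mem_nhds.2 fun z hz => ?_
  obtain ⟨r, hr, hD⟩ := Metric.isOpen_iff.1 (isOpen_markedFatou f) z hz.1
  filter_upwards [Metric.ball_mem_nhds z (show 0 < r / 5 by linarith)] with w hw
  exact ⟨hD (Metric.ball_subset_ball (by linarith) hw), fun h =>
    h.not_accPt (accPt_grandOrbit_of_not_isLocallyTrivial hf hD hz.2 hw)⟩

/-- On the grand orbit of a connected subset of the marked Fatou set, local triviality of the grand
orbit relation holds everywhere or nowhere. -/
theorem isLocallyTrivial_of_isLocallyTrivial (hf : Differentiable ℂ f) {C : Set ℂ}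
    (hC : IsPreconnected C) (hCF : C ⊆ markedFatou f) {z w : ℂ} (hz : z ∈ grandOrbitSet f C)
    (hw : w ∈ grandOrbitSet f C) (h : IsLocallyTrivialGrandOrbit f z) :
    IsLocallyTrivialGrandOrbit f w := by
  obtain ⟨c, hc, hcz⟩ := mem_grandOrbitSet.1 hz
  obtain ⟨d, hd, hdw⟩ := mem_grandOrbitSet.1 hw
  have hzF := mem_markedFatou_of_mem_grandOrbit hf (hCF hc) hcz
  have hwF := mem_markedFatou_of_mem_grandOrbit hf (hCF hd) hdw
  have hct : IsLocallyTrivialGrandOrbit f c := by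
    rw [isLocallyTrivial_iff_not_accPt hf hzF] at h
    rw [isLocallyTrivial_iff_not_accPt hf (hCF hc)]
    exact fun hacc => h (accPt_grandOrbit_of_mem hf (hCF hc) hacc hcz)
  have hdt : IsLocallyTrivialGrandOrbit f d := by
    by_contra hdn
    obtain ⟨x, -, hx, hx'⟩ := hC _ _ (isOpen_setOf_isLocallyTrivialGrandOrbit f)
      (isOpen_setOf_mem_markedFatou_not_isLocallyTrivial hf)
      (fun x hx => (em (IsLocallyTrivialGrandOrbit f x)).imp id fun hn => ⟨hCF hx, hn⟩)
      ⟨c, hc, hct⟩ ⟨d, hd, hCF hd, hdn⟩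
    exact hx'.2 hx
  rw [isLocallyTrivial_iff_not_accPt hf hwF]
  rw [isLocallyTrivial_iff_not_accPt hf (hCF hd)] at hdt
  exact fun hacc => hdt (accPt_grandOrbit_of_mem hf hwF hacc (mem_grandOrbit_comm.1 hdw))

theorem isDiscrete_iff_forall_not_accPt {s : Set ℂ} :
    IsDiscrete s ↔ ∀ x ∈ s, ¬ AccPt x (𝓟 s) := by
  rw [isDiscrete_iff_discreteTopology, discreteTopology_subtype_iff]
  simp only [AccPt, not_neBot]

/-- Accumulation at any point of the grand orbit is transported to `z`, so isolation of `z` alone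
decides discreteness. -/
theorem isDiscrete_grandOrbit_iff (hf : Differentiable ℂ f) {z : ℂ} (hz : z ∈ markedFatou f) :
    IsDiscrete (grandOrbit f z) ↔ IsLocallyTrivialGrandOrbit f z := by
  rw [isLocallyTrivial_iff_not_accPt hf hz, isDiscrete_iff_forall_not_accPt]
  refine ⟨fun h => h z (mem_grandOrbit_self f z), fun h w hw hacc => h ?_⟩
  rw [← grandOrbit_eq_of_mem hw] at hacc
  exact accPt_grandOrbit_of_mem hf (mem_markedFatou_of_mem_grandOrbit hf hz hw) hacc
    (mem_grandOrbit_comm.1 hw)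

end Dichotomy

/-! ### Wandering domains and the main theorem -/

section Wandering

variable {f : ℂ → ℂ}

theorem isOpen_fatouSet (f : ℂ → ℂ) : IsOpen (fatouSet f) := by
  refine isOpen_iff_mem_nhds.2 fun z ⟨N, hN, hz, hn⟩ => ?_
  filter_upwards [hN.mem_nhds hz] with w hw using ⟨N, hN, hw, hn⟩

/-- If all iterates of `f` are injective on a neighbourhood of a point of the grand orbit of a
wandering domain, then the grand orbit relation is trivial near that point. -/
theorem IsWanderingDomain.isLocallyTrivialGrandOrbit (hf : Differentiable ℂ f) {U : Set ℂ}
    (hU : IsWanderingDomain f U) {z : ℂ} (hz : z ∈ grandOrbitSet f U) {W : Set ℂ} (hW : W ∈ 𝓝 z)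
    (hinj : ∀ n : ℕ, InjOn f^[n] W) : IsLocallyTrivialGrandOrbit f z := by
  obtain ⟨D, rfl, hDc, hDf, hdisj⟩ := hU
  obtain ⟨u, hu, a, b, hab⟩ := mem_grandOrbitSet.1 hz
  have hiter : ∀ n k, MapsTo f^[n] (D k) (D (k + n)) := fun n => by
    induction n with
    | zero => exact fun k => mapsTo_id _
    | succ n ih =>
      intro k x hx
      rw [Function.iterate_succ_apply', ← add_assoc]
      exact hDf _ ⟨_, ih k hx, rfl⟩
  have hopen : IsOpen (D a) := by
    obtain ⟨x, -, hx⟩ := hDc a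
    rw [hx]
    exact (isOpen_fatouSet f).connectedComponentIn
  have hza : f^[b] z ∈ D a := by
    rw [← hab]
    simpa using hiter a 0 hu
  have hpre := (hf.iterate b).continuous.continuousAt.preimage_mem_nhds (hopen.mem_nhds hza)
  -- Points here enter the same `D a` after the same number `b` of steps, so disjointness of the `D
  -- k` forces equal exponents in any orbit relation between them.
  refine ⟨W ∩ f^[b] ⁻¹' D a, inter_mem hW hpre, fun x hx => Subset.antisymm ?_ ?_⟩
  · rintro y ⟨⟨n, m, hnm⟩, hy⟩
    have hx' : f^[n] (f^[b] x) ∈ D (a + n) := hiter n a hx.2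
    have hy' : f^[m] (f^[b] y) ∈ D (a + m) := hiter m a hy.2
    have heq : f^[n] (f^[b] x) = f^[m] (f^[b] y) := by
      rw [← Function.iterate_add_apply, add_comm, Function.iterate_add_apply, hnm,
        ← Function.iterate_add_apply, add_comm, Function.iterate_add_apply]
    have : n = m := by
      by_contra hne
      exact disjoint_left.1 (hdisj (a + n) (a + m) (by omega)) hx' (heq ▸ hy')
    subst this
    exact (hinj n hx.1 hy.1 hnm).symm
  · exact singleton_subset_iff.2 ⟨mem_grandOrbit_self f x, hx⟩

theorem injOn_iterate_of_forall_injOn {W : Set ℂ} (h : ∀ n : ℕ, InjOn f (f^[n] '' W)) (n : ℕ) :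
    InjOn f^[n] W := by
  induction n with
  | zero => exact injOn_id _
  | succ n ih =>
    rw [Function.iterate_succ']
    exact (h n).comp ih (mapsTo_image _ _)

end Wandering

theorem isSimplyConnected_ball (z : ℂ) {r : ℝ} (hr : 0 < r) :
    IsSimplyConnected (Metric.ball z r) := by
  have := (convex_ball z r).contractibleSpace ⟨z, Metric.mem_ball_self hr⟩
  exact SimplyConnectedSpace.ofContractible _

theorem theoremA (f : ℂ → ℂ) (hf : Differentiable ℂ f) (V : Set ℂ)
    (hV : ∃ C : Set ℂ, IsComponentOf C (markedFatou f) ∧ V = grandOrbitSet f C) :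
    List.TFAE
      [ DiscreteGrandOrbitRelation f V,
        ∃ z ∈ V, IsDiscrete (grandOrbit f z),
        ∀ z ∈ V, ∃ U ∈ 𝓝 z, ∀ z' ∈ U, grandOrbit f z' ∩ U = {z'} ] ∧
    ((∃ U : Set ℂ, IsWanderingDomain f U ∧ V ⊆ grandOrbitSet f U) →
      List.TFAE
        [ DiscreteGrandOrbitRelation f V,
          ∃ z ∈ V, IsDiscrete (grandOrbit f z),
          ∀ z ∈ V, ∃ U ∈ 𝓝 z, ∀ z' ∈ U, grandOrbit f z' ∩ U = {z'},
          ∃ W : Set ℂ, W ⊆ V ∧ IsOpen W ∧ IsSimplyConnected W ∧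
            ∀ n : ℕ, InjOn f (f^[n] '' W) ]) := by
  obtain ⟨C, ⟨c, hc, hCc⟩, rfl⟩ := hV
  have hCF : C ⊆ markedFatou f := hCc ▸ connectedComponentIn_subset _ _
  have hCo : IsOpen C := hCc ▸ (isOpen_markedFatou f).connectedComponentIn
  have hCp : IsPreconnected C := hCc ▸ isPreconnected_connectedComponentIn
  have hcV : c ∈ grandOrbitSet f C :=
    mem_grandOrbitSet.2 ⟨c, hCc ▸ mem_connectedComponentIn hc, mem_grandOrbit_self f c⟩
  have hVF : ∀ z ∈ grandOrbitSet f C, z ∈ markedFatou f := fun z hz => by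
    obtain ⟨d, hd, hdz⟩ := mem_grandOrbitSet.1 hz
    exact mem_markedFatou_of_mem_grandOrbit hf (hCF hd) hdz
  have hab : DiscreteGrandOrbitRelation f (grandOrbitSet f C) →
      ∃ z ∈ grandOrbitSet f C, IsDiscrete (grandOrbit f z) := fun h => ⟨c, hcV, h c hcV⟩
  have hbc : (∃ z ∈ grandOrbitSet f C, IsDiscrete (grandOrbit f z)) →
      ∀ z ∈ grandOrbitSet f C, IsLocallyTrivialGrandOrbit f z := fun ⟨z, hz, hd⟩ w hw =>
    isLocallyTrivial_of_isLocallyTrivial hf hCp hCF hz hw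
      ((isDiscrete_grandOrbit_iff hf (hVF z hz)).1 hd)
  have hca : (∀ z ∈ grandOrbitSet f C, IsLocallyTrivialGrandOrbit f z) →
      DiscreteGrandOrbitRelation f (grandOrbitSet f C) := fun h z hz =>
    (isDiscrete_grandOrbit_iff hf (hVF z hz)).2 (h z hz)
  refine ⟨?_, fun ⟨U, hU, hVU⟩ => ?_⟩
  · tfae_have 1 → 2 := hab
    tfae_have 2 → 3 := hbc
    tfae_have 3 → 1 := hca
    tfae_finish
  · tfae_have 1 → 2 := hab
    tfae_have 2 → 3 := hbc
    tfae_have 3 → 1 := hca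
    tfae_have 3 → 4 := fun h => by
      obtain ⟨U, hU, hUt⟩ := h c hcV
      obtain ⟨r, hr, hrU⟩ := Metric.mem_nhds_iff.1
        (inter_mem hU (grandOrbitSet_mem_nhds hf hCo hCF hcV))
      refine ⟨Metric.ball c r, fun x hx => (hrU hx).2, Metric.isOpen_ball,
        isSimplyConnected_ball c hr, fun n => ?_⟩
      rintro _ ⟨x, hx, rfl⟩ _ ⟨y, hy, rfl⟩ hxy
      rw [← Function.iterate_succ_apply' f, ← Function.iterate_succ_apply' f] at hxy
      have hyx : y ∈ grandOrbit f x ∩ U := ⟨⟨n + 1, n + 1, hxy⟩, (hrU hy).1⟩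
      rw [hUt x (hrU hx).1] at hyx
      rw [show y = x from hyx]
    -- Only this implication needs the wandering hypothesis; simple connectedness supplies a point
    -- of `W`.
    tfae_have 4 → 2 := fun ⟨W, hWV, hWo, hWs, hWi⟩ => by
      obtain ⟨z, hz⟩ := hWs.nonempty
      exact ⟨z, hWV hz, (isDiscrete_grandOrbit_iff hf (hVF z (hWV hz))).2
        (hU.isLocallyTrivialGrandOrbit hf (hVU (hWV hz)) (hWo.mem_nhds hz)
          (injOn_iterate_of_forall_injOn hWi))⟩
    tfae_finish
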